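/- Let $n\ge 3$ be odd. Let $\mathbb B=\{0,1\}$, let $\neg$ be Boolean complementation, and for odd $i$ let $M_i:\mathbb B^i\to\mathbb B$ be the majority function, which is $1$ exactly when at least $\lceil i/2\rceil$ of its $i$ inputs are $1$. Formulas of $(\mathbb B,M_n,\neg,0,1)$ are built from variables and the constants $0,1$ with $\neg$ and the operators $M_i$, where $i$ is odd and $3\le i\le n$. An identity $s=t$ between formulas is valid if $s$ and $t$ have the same value under every assignment of values in $\mathbb B$ to the variables. Let $\Omega_n$ be the following five laws, for every odd $i$ with $3\le i\le n$ and all formulas $x_j,y_j,z_j,x,y,w$. 1. Commutativity: $M_i(x_1,\dots,x_i)$ is unchanged when two of its inputs are exchanged. 2. Majority: if $\lceil i/2\rceil$ of $x_1,\dots,x_i$ are the formula $y$, then $M_i(x_1,\dots,x_i)=y$. If $x_p,x_q$ ($p\ne q$) are complementary, that is, one of them is the complement $\neg u$ of the other one, $u$, or they are the constants $0$ and $1$ in some order, then $M_i(x_1,\dots,x_i)=M_{i-2}(y_1,\dots,y_{i-2})$, where $y_1,\dots,y_{i-2}$ is $x_1,\dots,x_i$ without $x_p$ and $x_q$; here $M_1(y_1)$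 stands for $y_1$. 3. Associativity: $M_i(z_1,\dots,z_{i-2},y,M_i(z_1,\dots,z_{i-2},x,w))=M_i(z_1,\dots,z_{i-2},x,M_i(z_1,\dots,z_{i-2},y,w))$. 4. Distributivity: $M_i(x_1,\dots,x_{i-1},M_i(y_1,\dots,y_i))=M_i(u_1,\dots,u_k,y_{k+1},\dots,y_i)$ with $u_j=M_i(x_1,\dots,x_{i-1},y_j)$, for those $k$ among $\lceil i/2\rceil$, $\lceil i/2\rceil+1$ and $i-1$ that are at most $i-1$. 5. Inverter propagation: $\neg M_i(x_1,\dots,x_i)=M_i(\neg x_1,\dots,\neg x_i)$. Then $\Omega_n$ is complete for $(\mathbb B,M_n,\neg,0,1)$: every valid identity $s=t$ between formulas can be derived from the laws of $\Omega_n$ by equational reasoning (reflexivity, symmetry, transitivity, and replacement of equals inside $\neg$ and the $M_i$). -/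

import Mathlib

namespace MajLogic

/-- The threshold `⌈i / 2⌉`, with exact rounding up of `i / 2`. -/
def threshold (i : ℕ) : ℕ := (i + 1) / 2

/-- The majority function `M_i` on the Boolean domain: true iff at least `⌈i / 2⌉` of the
inputs are true (`i` is odd wherever it is used). -/
def majority {i : ℕ} (x : Fin i → Bool) : Bool :=
  decide (threshold i ≤ (Finset.univ.filter fun j => x j = true).card)

/-- The arities of the majority operators of the logic: `M_n` stands for all the operators `M_i`
with `i` odd and `3 ≤ i ≤ n`. -/
def IsArity (n i : ℕ) : Prop := Odd i ∧ 3 ≤ i ∧ i ≤ n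

/-- Formulas of `(𝔹, M_n, ¬, 0, 1)` with variables from `α`. -/
inductive Formula (n : ℕ) (α : Type*) where
  | var (a : α) : Formula n α
  | zero : Formula n α
  | one : Formula n α
  | neg (t : Formula n α) : Formula n α
  | maj {i : ℕ} (hi : IsArity n i) (x : Fin i → Formula n α) : Formula n α

/-- The Boolean value of a formula under an assignment of the variables. -/
def Formula.eval {n : ℕ} {α : Type*} (v : α → Bool) : Formula n α → Bool
  | .var a => v a
  | .zero => false
  | .one => true
  | .neg t => !(t.eval v)
  | .maj _ x => majority fun j => (x j).eval v

/-- The condition `x ≠ y` of the majority law, for formulas: one of the two is the complement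
of the other, or they are the two distinct constants. -/
def Complementary {n : ℕ} {α : Type*} (s t : Formula n α) : Prop :=
  s = .neg t ∨ t = .neg s ∨ (s = .zero ∧ t = .one) ∨ (s = .one ∧ t = .zero)

open Formula in
/-- `Omega n s t`: the equation `s = t` is an instance of one of the five laws `Ω_n`, at one of
the arities `i` of the language (`i` odd, `3 ≤ i ≤ n`). -/
inductive Omega (n : ℕ) {α : Type*} : Formula n α → Formula n α → Prop
  /-- Commutativity: exchange of the inputs at two positions. -/
  | commutativity {i : ℕ} (hi : IsArity n i) (x : Fin i → Formula n α) (p q : Fin i) :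
      Omega n (maj hi x) (maj hi fun j => x (Equiv.swap p q j))
  /-- Majority, decision: `⌈i / 2⌉` of the inputs are `y`. -/
  | majority_decision {i : ℕ} (hi : IsArity n i) (x : Fin i → Formula n α) (y : Formula n α)
      (S : Finset (Fin i)) (hS : S.card = threshold i) (hx : ∀ j ∈ S, x j = y) :
      Omega n (maj hi x) y
  /-- Majority, reduction: removal of two complementary inputs, at the distinct positions `p`
  and `p.succAbove q`, turns `M_{i+2}` into `M_i`. -/
  | majority_reduction {i : ℕ} (hi : IsArity n i) (hi' : IsArity n (i + 2))
      (x : Fin (i + 2) → Formula n α) (p : Fin (i + 2)) (q : Fin (i + 1))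
      (hx : Complementary (x p) (x (p.succAbove q))) :
      Omega n (maj hi' x) (maj hi fun j => x (p.succAbove (q.succAbove j)))
  /-- Majority, boundary case of the reduction: from `M_3` only the remaining input is left. -/
  | majority_boundary (hi : IsArity n 3) (x : Fin 3 → Formula n α) (p : Fin 3) (q : Fin 2)
      (hx : Complementary (x p) (x (p.succAbove q))) :
      Omega n (maj hi x) (x (p.succAbove (q.succAbove 0)))
  /-- Associativity, at arity `m + 2`. -/
  | associativity {m : ℕ} (hi : IsArity n (m + 2)) (z : Fin m → Formula n α)
      (x y w : Formula n α) :
      Omega n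
        (maj hi (Fin.append z ![y, maj hi (Fin.append z ![x, w])]))
        (maj hi (Fin.append z ![x, maj hi (Fin.append z ![y, w])]))
  /-- Distributivity, at arity `m + 1`, over the first `k` inputs of the inner operator, where
  `k` is `⌈(m + 1) / 2⌉`, `⌈(m + 1) / 2⌉ + 1` or `m`, and at most `m`. -/
  | distributivity {m : ℕ} (hi : IsArity n (m + 1)) (x : Fin m → Formula n α)
      (y : Fin (m + 1) → Formula n α) (k : ℕ)
      (hk : k = threshold (m + 1) ∨ k = threshold (m + 1) + 1 ∨ k = m) (hkm : k ≤ m) :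
      Omega n
        (maj hi (Fin.append x ![maj hi y]))
        (maj hi fun j => if (j : ℕ) < k then maj hi (Fin.append x ![y j]) else y j)
  /-- Inverter propagation. -/
  | inverter_propagation {i : ℕ} (hi : IsArity n i) (x : Fin i → Formula n α) :
      Omega n (neg (maj hi x)) (maj hi fun j => neg (x j))

/-- `Derivable n s t`: the identity `s = t` can be derived from the laws `Ω_n` in equational
logic. The laws are schemes over all formulas, so that substitution instances are included. -/
inductive Derivable (n : ℕ) {α : Type*} : Formula n α → Formula n α → Prop
  | law {s t : Formula n α} (h : Omega n s t) : Derivable n s t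
  | refl (s : Formula n α) : Derivable n s s
  | symm {s t : Formula n α} (h : Derivable n s t) : Derivable n t s
  | trans {s t u : Formula n α} (h : Derivable n s t) (h' : Derivable n t u) : Derivable n s u
  | neg_congr {s t : Formula n α} (h : Derivable n s t) :
      Derivable n (Formula.neg s) (Formula.neg t)
  | maj_congr {i : ℕ} (hi : IsArity n i) {x y : Fin i → Formula n α}
      (h : ∀ j, Derivable n (x j) (y j)) : Derivable n (Formula.maj hi x) (Formula.maj hi y)

/-- The identity `s = t` is valid in the Boolean domain. -/
def Valid {n : ℕ} {α : Type*} (s t : Formula n α) : Prop :=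
  ∀ v : α → Bool, s.eval v = t.eval v

end MajLogic

/-!
Completeness follows from the prime ideal theorem, applied to the Lindenbaum algebra `Lindenbaum n α`
of formulas modulo derivability.

The laws at arity `3` make this quotient a Boolean algebra, with meet `M₃(0, a, b)`, join
`M₃(1, a, b)` and complement `¬`. The operators of higher arity are tied to this structure by
distributivity: if the outer operator has the inputs `0, 1, …, 0, 1, 0, a`, the reduction law turns
it into `a ⊓ ·`, and so `a ⊓ M_i(y)` can be computed by meeting all inputs but one with `a`. Doing
this twice, with a different exceptional input each time, gives
`a ⊓ M_i(y₁, …, y_i) = M_i(a ⊓ y₁, …, a ⊓ y_i)` (`inf_op`). Hence agreement below `a` is preserved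
by every `M_i` (`inf_op_congr`).

If `s = t` is not derivable, some prime ideal `J` of the Lindenbaum algebra contains the class of
exactly one of `s` and `t`. Modulo `J` every class is `0` or `1`. The operators `M_i` respect this
reduction by `inf_op_congr`, and on constants the decision law evaluates them as the majority
function (`op_const`). So membership in the complement of `J` is evaluation under an assignment
(`notMem_iff_eval`), and this assignment gives `s` and `t` different values.
-/

namespace MajLogic

variable {n : ℕ} {α : Type*}

/-! ### The Lindenbaum algebra -/

/-- Formulas up to derivable equality. -/
def derivableSetoid (n : ℕ) (α : Type*) : Setoid (Formula n α) where
  r := Derivable n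
  iseqv := ⟨.refl, .symm, .trans⟩

/-- The Lindenbaum algebra of the logic: formulas modulo derivability from `Ω_n`. -/
def Lindenbaum (n : ℕ) (α : Type*) : Type _ := Quotient (derivableSetoid n α)

namespace Lindenbaum

/-- The class of a formula in the Lindenbaum algebra. -/
def mk (s : Formula n α) : Lindenbaum n α := Quotient.mk (derivableSetoid n α) s

theorem mk_eq_mk {s t : Formula n α} : mk s = mk t ↔ Derivable n s t :=
  Quotient.eq (r := derivableSetoid n α)

theorem mk_eq_of_omega {s t : Formula n α} (h : Omega n s t) : mk s = mk t :=
  mk_eq_mk.2 (.law h)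

theorem mk_surjective : Function.Surjective (mk : Formula n α → Lindenbaum n α) :=
  Quotient.mk_surjective

theorem exists_rep {ι : Type*} (y : ι → Lindenbaum n α) :
    ∃ x : ι → Formula n α, y = fun j => mk (x j) :=
  ⟨fun j => (mk_surjective (y j)).choose, funext fun j => (mk_surjective (y j)).choose_spec.symm⟩

/-- The operator `M_i` on classes, defined through representatives of the inputs. -/
noncomputable def op {i : ℕ} (hi : IsArity n i) (y : Fin i → Lindenbaum n α) : Lindenbaum n α :=
  mk (.maj hi (exists_rep y).choose)

theorem op_mk {i : ℕ} (hi : IsArity n i) (x : Fin i → Formula n α) :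
    op hi (fun j => mk (x j)) = mk (.maj hi x) :=
  mk_eq_mk.2 <| .maj_congr hi fun j =>
    mk_eq_mk.1 (congrFun (exists_rep fun j => mk (x j)).choose_spec j).symm

theorem op_swap {i : ℕ} (hi : IsArity n i) (y : Fin i → Lindenbaum n α) (p q : Fin i) :
    op hi (fun j => y (Equiv.swap p q j)) = op hi y := by
  obtain ⟨x, rfl⟩ := exists_rep y
  rw [op_mk hi x, op_mk hi fun j => x (Equiv.swap p q j)]
  exact (mk_eq_of_omega (.commutativity hi x p q)).symm

/-! ### The laws for three inputs -/

section Ternary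

variable (h3 : IsArity n 3)

/-- The ternary majority operator on classes. -/
noncomputable def med (a b c : Lindenbaum n α) : Lindenbaum n α := op h3 ![a, b, c]

theorem med_mk (a b c : Formula n α) :
    med h3 (mk a) (mk b) (mk c) = mk (.maj h3 ![a, b, c]) := by
  rw [← op_mk, med]
  congr 1
  ext j
  fin_cases j <;> rfl

theorem med_swap_left (a b c : Lindenbaum n α) : med h3 a b c = med h3 b a c := by
  rw [med, ← op_swap h3 _ 0 1, med]
  congr 1
  ext j
  fin_cases j <;> rfl

theorem med_swap_right (a b c : Lindenbaum n α) : med h3 a b c = med h3 a c b := by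
  rw [med, ← op_swap h3 _ 1 2, med]
  congr 1
  ext j
  fin_cases j <;> rfl

theorem med_self (a b : Lindenbaum n α) : med h3 a a b = a := by
  obtain ⟨a, rfl⟩ := mk_surjective a
  obtain ⟨b, rfl⟩ := mk_surjective b
  rw [med_mk]
  refine mk_eq_of_omega (.majority_decision h3 _ a {0, 1} rfl ?_)
  simp

theorem med_mk_of_complementary {s t : Formula n α} (h : Complementary s t)
    (a : Lindenbaum n α) : med h3 (mk s) (mk t) a = a := by
  obtain ⟨a, rfl⟩ := mk_surjective a
  rw [med_mk]
  exact mk_eq_of_omega (.majority_boundary h3 ![s, t, a] 0 0 h)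

theorem med_assoc (a b c d : Lindenbaum n α) :
    med h3 a b (med h3 a c d) = med h3 a c (med h3 a b d) := by
  obtain ⟨a, rfl⟩ := mk_surjective a
  obtain ⟨b, rfl⟩ := mk_surjective b
  obtain ⟨c, rfl⟩ := mk_surjective c
  obtain ⟨d, rfl⟩ := mk_surjective d
  simp only [med_mk]
  have h := mk_eq_of_omega (.associativity h3 ![a] c b d)
  have e : ∀ u v : Formula n α, Fin.append ![a] ![u, v] = ![a, u, v] := fun u v => by
    ext j
    fin_cases j <;> rfl
  simpa only [e] using h

theorem med_distrib (a b c d e : Lindenbaum n α) :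
    med h3 a b (med h3 c d e) = med h3 (med h3 a b c) (med h3 a b d) e := by
  obtain ⟨a, rfl⟩ := mk_surjective a
  obtain ⟨b, rfl⟩ := mk_surjective b
  obtain ⟨c, rfl⟩ := mk_surjective c
  obtain ⟨d, rfl⟩ := mk_surjective d
  obtain ⟨e, rfl⟩ := mk_surjective e
  simp only [med_mk]
  have h := mk_eq_of_omega (.distributivity h3 ![a, b] ![c, d, e] 2 (.inl rfl) le_rfl)
  have e1 : ∀ u : Formula n α, Fin.append ![a, b] ![u] = ![a, b, u] := fun u => by
    ext j
    fin_cases j <;> rfl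
  simp only [e1] at h
  refine h.trans (congrArg (fun x => mk (.maj h3 x)) ?_)
  ext j
  fin_cases j <;> rfl

end Ternary

/-! ### The Boolean algebra structure -/

section Boolean

/-- The class of the constant formula with value `b`. -/
def const (b : Bool) : Lindenbaum n α := mk (bif b then .one else .zero)

/-- The decision law suffices to compute the operators on constants, as one of the two constants
fills at least half of the inputs. -/
theorem op_const {i : ℕ} (hi : IsArity n i) (b : Fin i → Bool) :
    op hi (fun j => (const (b j) : Lindenbaum n α)) = const (majority b) := by
  have hS : threshold i ≤ (Finset.univ.filter fun j => b j = majority b).card := by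
    cases h : majority b
    · have h' : ¬ threshold i ≤ (Finset.univ.filter fun j => b j = true).card := by
        simpa [majority] using h
      have hc := Finset.card_filter_add_card_filter_not (s := (Finset.univ : Finset (Fin i)))
        (fun j => b j = true)
      simp only [Finset.card_univ, Fintype.card_fin, Bool.not_eq_true] at hc
      obtain ⟨k, hk⟩ := hi.1
      simp only [threshold] at h' ⊢
      omega
    · simpa [majority] using h
  obtain ⟨S, hSs, hSc⟩ := Finset.exists_subset_card_eq hS
  rw [const, ← mk_eq_of_omega (.majority_decision hi (fun j => bif b j then .one else .zero) _ S hSc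
    fun j hj => by rw [(Finset.mem_filter.1 (hSs hj)).2]), ← op_mk]
  rfl

theorem med_const (h3 : IsArity n 3) (b : Bool) (a : Lindenbaum n α) :
    med h3 (const b) a (const !b) = a := by
  rw [med_swap_right]
  apply med_mk_of_complementary
  cases b <;> simp [Complementary]

/-- For `b = false` this says that join absorbs meet, for `b = true` that meet absorbs join. -/
theorem med_absorb (h3 : IsArity n 3) (b : Bool) (x y : Lindenbaum n α) :
    med h3 (const !b) x (med h3 (const b) x y) = x := by
  have h : med h3 (const !b) x (const b) = x := by
    simpa using med_const h3 (!b) x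
  rw [med_distrib, h, med_swap_left h3 _ x x, med_swap_right h3 x _ x, med_self, med_self]

/-- The negation on classes. -/
def neg : Lindenbaum n α → Lindenbaum n α :=
  Quotient.map' (s₁ := derivableSetoid n α) (s₂ := derivableSetoid n α) Formula.neg
    fun _ _ h => .neg_congr h

theorem med_neg (h3 : IsArity n 3) (a x : Lindenbaum n α) : med h3 a x (neg x) = a := by
  obtain ⟨x, rfl⟩ := mk_surjective x
  rw [med_swap_left, med_swap_right]
  exact med_mk_of_complementary h3 (t := x.neg) (.inr (.inl rfl)) a

/-- Associativity of `M₃(b, ·, ·)`, which is the meet if `b` is the class of `0` and the join if `b`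
is the class of `1`. -/
theorem med_assoc' (h3 : IsArity n 3) (b x y z : Lindenbaum n α) :
    med h3 b (med h3 b x y) z = med h3 b x (med h3 b y z) := by
  rw [med_swap_right, med_assoc, med_swap_right h3 b z y]

variable [h3 : Fact (IsArity n 3)]

noncomputable instance : Lattice (Lindenbaum n α) :=
  letI : Max (Lindenbaum n α) := ⟨med h3.out (const true)⟩
  letI : Min (Lindenbaum n α) := ⟨med h3.out (const false)⟩
  Lattice.mk' (fun _ _ => med_swap_right ..) (fun _ _ _ => med_assoc' ..)
    (fun _ _ => med_swap_right ..) (fun _ _ _ => med_assoc' ..)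
    (fun _ _ => med_absorb h3.out false ..) (fun _ _ => med_absorb h3.out true ..)

theorem inf_def (a b : Lindenbaum n α) : a ⊓ b = med h3.out (const false) a b := rfl

theorem sup_def (a b : Lindenbaum n α) : a ⊔ b = med h3.out (const true) a b := rfl

noncomputable instance : DistribLattice (Lindenbaum n α) :=
  .ofInfSupLe fun a b c => by
    simp only [inf_def, sup_def]
    -- The distributive law of the median has the outer constant in its last place.
    rw [med_swap_left _ (const true) b c, med_swap_right _ b, med_distrib,
      med_swap_right, med_swap_left _ _ (const true)]

noncomputable instance : BooleanAlgebra (Lindenbaum n α) where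
  compl := neg
  top := const true
  bot := const false
  le_top a := inf_eq_left.1 (med_const h3.out false a)
  bot_le a := sup_eq_right.1 <| by
    rw [sup_def, med_swap_right]
    exact med_const h3.out true a
  inf_compl_le_bot a := (med_neg h3.out _ a).le
  top_le_sup_compl a := (med_neg h3.out _ a).ge

theorem mk_neg (s : Formula n α) : mk s.neg = (mk s)ᶜ := rfl

theorem const_true : (const true : Lindenbaum n α) = ⊤ := rfl

theorem const_false : (const false : Lindenbaum n α) = ⊥ := rfl

/-! ### Operators of higher arity -/

/-- Every operator `M_{m+1}` becomes the meet with a given class when its first `m` inputs are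
chosen suitably. -/
theorem exists_maj_append_eq_inf (a : Formula n α) {m : ℕ} (hm : IsArity n (m + 1)) :
    ∃ x : Fin m → Formula n α, ∀ w, mk (.maj hm (Fin.append x ![w])) = mk a ⊓ mk w := by
  induction m using Nat.strong_induction_on with
  | _ m ih =>
  match m, hm, ih with
  | 0, hm, _ => exact absurd hm.2.1 (by norm_num)
  | 1, hm, _ => exact absurd hm.2.1 (by norm_num)
  | 2, hm, _ =>
    refine ⟨![.zero, a], fun w => ?_⟩
    rw [inf_def]
    refine Eq.trans ?_ (med_mk h3.out .zero a w).symm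
    congr 2
    ext j
    fin_cases j <;> rfl
  | 3, hm, _ => exact absurd hm.1 (by decide)
  | m + 4, hm, ih =>
    have hm' : IsArity n (m + 2 + 1) :=
      ⟨(Nat.odd_add.1 (show Odd (m + 2 + 1 + 2) from hm.1)).2 even_two, by omega,
        by have := hm.2.2; omega⟩
    obtain ⟨x, hx⟩ := ih (m + 2) (by omega) hm'
    -- Two new inputs `0` and `1` cancel by the reduction law.
    refine ⟨Fin.cons .zero (Fin.cons .one x), fun w => ?_⟩
    rw [← hx w]
    refine (mk_eq_of_omega (.majority_reduction hm' hm _ 0 0 ?_)).trans ?_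
    · exact .inr (.inr (.inl ⟨rfl, rfl⟩))
    · congr 2
      ext j
      refine Fin.lastCases ?_ (fun j => ?_) j
      · exact (Fin.append_right _ ![w] 0).trans (Fin.append_right x ![w] 0).symm
      · exact (Fin.append_left _ ![w] j.succ.succ).trans (Fin.append_left x ![w] j).symm

/-- Distributivity for the meet, with `p` as the exceptional input. -/
theorem inf_op_update {i : ℕ} (hi : IsArity n i) (a : Lindenbaum n α)
    (y : Fin i → Lindenbaum n α) (p : Fin i) :
    a ⊓ op hi y = op hi fun j => if j = p then y j else a ⊓ y j := by
  obtain ⟨m, rfl⟩ : ∃ m, i = m + 1 := ⟨i - 1, by have := hi.2.1; omega⟩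
  have key : ∀ y : Fin (m + 1) → Lindenbaum n α,
      a ⊓ op hi y = op hi fun j => if j = Fin.last m then y j else a ⊓ y j := by
    intro y
    obtain ⟨a, rfl⟩ := mk_surjective a
    obtain ⟨y, rfl⟩ := exists_rep y
    obtain ⟨x, hx⟩ := exists_maj_append_eq_inf a hi
    rw [op_mk hi y, ← hx, mk_eq_of_omega (.distributivity hi x y m (.inr (.inr rfl)) le_rfl),
      ← op_mk]
    congr 1
    ext j
    by_cases hj : j = Fin.last m
    · simp [hj]
    · rw [if_pos (Fin.val_lt_last hj), if_neg hj, hx]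
  rw [← op_swap hi y p (Fin.last m), key, ← op_swap hi _ p (Fin.last m)]
  simp [Equiv.swap_apply_eq_iff]

theorem inf_op {i : ℕ} (hi : IsArity n i) (a : Lindenbaum n α) (y : Fin i → Lindenbaum n α) :
    a ⊓ op hi y = op hi fun j => a ⊓ y j := by
  have h0 : 0 < i := by have := hi.2.1; omega
  have h1 : 1 < i := by have := hi.2.1; omega
  rw [← inf_idem a, inf_assoc, inf_op_update hi a y ⟨0, h0⟩, inf_op_update hi a _ ⟨1, h1⟩]
  congr 1
  ext j
  by_cases hj0 : j = ⟨0, h0⟩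
  · simp [hj0]
  · by_cases hj1 : j = ⟨1, h1⟩ <;> simp [hj0, hj1]

theorem inf_op_congr {i : ℕ} (hi : IsArity n i) {a : Lindenbaum n α}
    {y z : Fin i → Lindenbaum n α} (h : ∀ j, a ⊓ y j = a ⊓ z j) :
    a ⊓ op hi y = a ⊓ op hi z := by
  rw [inf_op, inf_op, funext h]

/-! ### Prime ideals as assignments -/

/-- Evaluation under the assignment read off from a prime ideal `J` decides membership in `J`. -/
theorem notMem_iff_eval {J : Order.Ideal (Lindenbaum n α)} (hJ : J.IsPrime)
    {v : α → Bool} (hv : ∀ a, mk (.var a) ∉ J ↔ v a = true) (s : Formula n α) :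
    mk s ∉ J ↔ s.eval v = true := by
  have compl_mem : ∀ c : Lindenbaum n α, cᶜ ∈ J ↔ c ∉ J := fun c =>
    ⟨fun h h' => hJ.1.top_notMem (by simpa using J.sup_mem h' h),
      hJ.mem_or_compl_mem.resolve_left⟩
  have top_notMem : ⊤ ∉ J := by
    rw [← compl_mem, compl_top]
    exact J.bot_mem
  induction s with
  | var a => exact hv a
  | zero => exact iff_of_false (not_not.2 J.bot_mem) Bool.false_ne_true
  | one => exact iff_of_true top_notMem rfl
  | neg t ih =>
    rw [mk_neg, compl_mem]
    exact (not_congr ih).trans (by simp [Formula.eval])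
  | @maj i hi x ih =>
    set b : Fin i → Bool := fun j => (x j).eval v
    -- The class `e` lies outside `J`, and below it every input agrees with its value.
    set e : Lindenbaum n α :=
      Finset.univ.inf fun j => if b j = true then mk (x j) else (mk (x j))ᶜ
    have he : e ∉ J := by
      refine Finset.inf_induction top_notMem (p := (· ∉ J))
        (fun c hc d hd h => (hJ.mem_or_mem h).elim hc hd) fun j _ => ?_
      split_ifs with hb
      · exact (ih j).2 hb
      · rw [compl_mem]
        exact fun h => hb ((ih j).1 h)
    have hej : ∀ j, e ⊓ mk (x j) = e ⊓ const (b j) := fun j => by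
      have hle : e ≤ if b j = true then mk (x j) else (mk (x j))ᶜ :=
        Finset.inf_le (Finset.mem_univ j)
      cases hb : b j
      · rw [const_false, inf_bot_eq]
        exact (le_compl_iff_disjoint_right.1 (by simpa [hb] using hle)).eq_bot
      · rw [const_true, inf_top_eq]
        exact inf_eq_left.2 (by simpa [hb] using hle)
    have hmaj : e ⊓ mk (.maj hi x) = e ⊓ const (majority b) := by
      rw [← op_mk, inf_op_congr hi hej, op_const]
    have hinf : ∀ c, e ⊓ c ∈ J ↔ c ∈ J := fun c =>
      ⟨fun h => (hJ.mem_or_mem h).resolve_left he, fun h => J.lower inf_le_right h⟩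
    rw [← hinf, hmaj, hinf]
    change _ ↔ majority b = true
    cases majority b
    · exact iff_of_false (not_not.2 J.bot_mem) Bool.false_ne_true
    · exact iff_of_true top_notMem rfl

/-- If the inequality fails, a prime ideal that contains `mk t` but not `mk s` yields an assignment
under which `s` is true and `t` is false. -/
theorem mk_le_mk_of_valid {s t : Formula n α} (h : Valid s t) : mk s ≤ mk t := by
  by_contra hle
  obtain ⟨J, hJ, htJ, hsJ⟩ := DistribLattice.prime_ideal_of_disjoint_filter_ideal
    (F := Order.PFilter.principal (mk s)) (I := Order.Ideal.principal (mk t)) <| by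
      rw [Set.disjoint_left]
      exact fun c hc hc' => hle (le_trans hc hc')
  classical
  have key := notMem_iff_eval hJ (v := fun a => decide (mk (.var a) ∉ J)) (by simp)
  have hs : mk s ∉ J := Set.disjoint_left.1 hsJ (Order.PFilter.mem_principal.2 le_rfl)
  have ht : mk t ∈ J := htJ (Order.Ideal.mem_principal_self)
  exact (key t).2 ((h _).symm.trans ((key s).1 hs)) ht

end Boolean

end Lindenbaum

end MajLogic

theorem theorem2 (n : ℕ) (hn : Odd n) (hn3 : 3 ≤ n) {α : Type*}
    (s t : MajLogic.Formula n α) (hst : MajLogic.Valid s t) :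
    MajLogic.Derivable n s t := by
  have : Fact (MajLogic.IsArity n 3) := ⟨by decide, le_rfl, hn3⟩
  exact MajLogic.Lindenbaum.mk_eq_mk.1 <| le_antisymm
    (MajLogic.Lindenbaum.mk_le_mk_of_valid hst)
    (MajLogic.Lindenbaum.mk_le_mk_of_valid fun v => (hst v).symm)
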